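/- Let $\Gamma$ be a discrete group, let $X$ and $Y$ be compact Hausdorff spaces on which $\Gamma$ acts by homeomorphisms, with $X\neq\emptyset$, and let $\pi:X\to Y$ be a continuous $\Gamma$-equivariant surjection. For a compact Hausdorff $\Gamma$-space $Z$ let $C(Z)\rtimes_r\Gamma$ be the reduced crossed product, that is, the closed linear span of the operators $\sigma(f)\lambda_s$ ($f\in C(Z)$, $s\in\Gamma$) on $\ell^2(\Gamma,\mathcal H)$, where $C(Z)\subseteq \mathbb B(\mathcal H)$ is a faithful representation, $(\lambda_s\xi)(t)=\xi(s^{-1}t)$, $(\sigma(f)\xi)(t)=\alpha_{t^{-1}}(f)\,\xi(t)$ and $\alpha_s(f)=f\circ s^{-1}$; let $\mathbb E: C(Z)\rtimes_r\Gamma\to C(Z)$ be the canonical conditional expectation, $\mathbb E(\sigma(f)\lambda_s)=f$ if $s=e$ and $0$ otherwise. Let $H\le\Gamma$ be a subgroup such that 1. the action of $H$ on $X$ is minimal (every $H$-orbit is dense in $X$), and 2. $H$ is $Y$-plump: for every $\varepsilon>0$ and every $a\in C(Y)\rtimes_r\Gamma$ there are $s_1,\dots,s_m\in H$ and nonnegative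 functions $g_1,\dots,g_m\in C(Y)$ with $\sum_{j=1}^m g_j^2=1$ such that $$\Bigl\|\sum_{j=1}^m g_j\,\lambda_{s_j}\,a\,\lambda_{s_j}^*\,g_j-\mathbb E(a)\Bigr\|<\varepsilon ,$$ where elements of $C(Y)$ are identified with their images under $\sigma$. Regard $C(Y)\rtimes_r H$ as the subalgebra of $C(X)\rtimes_r\Gamma$ that is the closed linear span of the elements $\sigma(f\circ\pi)\lambda_h$ ($f\in C(Y)$, $h\in H$). Then every $C^*$-algebra $\mathcal A$ with $$C(Y)\rtimes_r H\subseteq\mathcal A\subseteq C(X)\rtimes_r\Gamma$$ is simple: $\mathcal A\ne 0$, and its only two-sided ideals are $0$ and $\mathcal A$. -/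

import Mathlib

noncomputable section

namespace CrossedProduct

/-- The Hilbert space `ℓ²(Γ, K)` of square-summable `K`-valued functions on `Γ`. -/
abbrev L2 (Γ K : Type*) [NormedAddCommGroup K] : Type _ := lp (fun _ : Γ => K) 2

/-- The action of `Γ` on `C(X)`: `(α_s f)(x) = f (s⁻¹ x)`. -/
def act {Γ X : Type*} [Group Γ] [TopologicalSpace X] [MulAction Γ X] [ContinuousConstSMul Γ X]
    (s : Γ) (f : C(X, ℂ)) : C(X, ℂ) :=
  f.comp ⟨fun x => s⁻¹ • x, continuous_const_smul s⁻¹⟩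

theorem norm_act_le {Γ X : Type*} [Group Γ] [TopologicalSpace X] [CompactSpace X]
    [MulAction Γ X] [ContinuousConstSMul Γ X] (s : Γ) (f : C(X, ℂ)) : ‖act s f‖ ≤ ‖f‖ :=
  (ContinuousMap.norm_le _ (norm_nonneg f)).2 fun x => f.norm_coe_le_norm (s⁻¹ • x)

/-- The left translation `(λ_s ξ)(t) = ξ (s⁻¹ t)` on `ℓ²(Γ, K)`. -/
def lam {Γ K : Type*} [Group Γ] [NormedAddCommGroup K] [InnerProductSpace ℂ K]
    (s : Γ) : L2 Γ K →L[ℂ] L2 Γ K :=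
  LinearMap.mkContinuous
    { toFun := fun ξ => ⟨fun t => ξ (s⁻¹ * t), by
        have h := (lp.memℓp ξ).summable (by norm_num)
        exact memℓp_gen ((Equiv.mulLeft s⁻¹).summable_iff.2 h)⟩
      map_add' := fun _ _ => rfl
      map_smul' := fun _ _ => rfl }
    1 fun ξ => by
      rw [one_mul]
      have h2 : 0 < (2 : ENNReal).toReal := by norm_num
      rw [lp.norm_eq_tsum_rpow h2, lp.norm_eq_tsum_rpow h2]
      exact le_of_eq (congrArg (· ^ (1 / (2 : ENNReal).toReal))
        ((Equiv.mulLeft s⁻¹).tsum_eq fun t => ‖ξ t‖ ^ (2 : ENNReal).toReal))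

@[simp]
theorem lam_apply {Γ K : Type*} [Group Γ] [NormedAddCommGroup K] [InnerProductSpace ℂ K]
    (s : Γ) (ξ : L2 Γ K) (t : Γ) : lam s ξ t = ξ (s⁻¹ * t) := rfl

/-- The representation of `C(X)` on `ℓ²(Γ, K)` induced by a representation `ρ` of `C(X)` on `K`:
`(σ(f) ξ)(t) = ρ(α_{t⁻¹} f) ξ(t)`. -/
def sig (Γ : Type*) {X K : Type*} [Group Γ] [TopologicalSpace X] [CompactSpace X]
    [MulAction Γ X] [ContinuousConstSMul Γ X]
    [NormedAddCommGroup K] [InnerProductSpace ℂ K] [CompleteSpace K]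
    (ρ : C(X, ℂ) →⋆ₐ[ℂ] (K →L[ℂ] K)) (f : C(X, ℂ)) : L2 Γ K →L[ℂ] L2 Γ K :=
  lp.mapCLM 2 (fun t : Γ => ρ (act t⁻¹ f)) (norm_nonneg f) fun t =>
    (NonUnitalStarAlgHom.norm_apply_le ρ _).trans (norm_act_le t⁻¹ f)

@[simp]
theorem sig_apply {Γ X K : Type*} [Group Γ] [TopologicalSpace X] [CompactSpace X]
    [MulAction Γ X] [ContinuousConstSMul Γ X]
    [NormedAddCommGroup K] [InnerProductSpace ℂ K] [CompleteSpace K]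
    (ρ : C(X, ℂ) →⋆ₐ[ℂ] (K →L[ℂ] K)) (f : C(X, ℂ)) (ξ : L2 Γ K) (t : Γ) :
    sig Γ ρ f ξ t = ρ (act t⁻¹ f) (ξ t) := rfl

/-- The reduced crossed product `C(X) ⋊_r Γ`, as the closed linear span of the operators
`σ(f) λ_s` (`f ∈ C(X)`, `s ∈ Γ`) on `ℓ²(Γ, K)`. -/
def reduced (Γ : Type*) {X K : Type*} [Group Γ] [TopologicalSpace X] [CompactSpace X]
    [MulAction Γ X] [ContinuousConstSMul Γ X]
    [NormedAddCommGroup K] [InnerProductSpace ℂ K] [CompleteSpace K]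
    (ρ : C(X, ℂ) →⋆ₐ[ℂ] (K →L[ℂ] K)) : Submodule ℂ (L2 Γ K →L[ℂ] L2 Γ K) :=
  (Submodule.span ℂ {T | ∃ (f : C(X, ℂ)) (s : Γ), T = sig Γ ρ f * lam s}).topologicalClosure

/-- The canonical copy of `C(Y) ⋊_r H` inside `C(X) ⋊_r Γ`, for a factor map `π : X → Y` and a
subgroup `H` of `Γ`: the closed linear span of the operators `σ(f ∘ π) λ_h`
(`f ∈ C(Y)`, `h ∈ H`). -/
def reducedSub {Γ X Y K : Type*} [Group Γ] [TopologicalSpace X] [CompactSpace X]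
    [MulAction Γ X] [ContinuousConstSMul Γ X] [TopologicalSpace Y]
    [NormedAddCommGroup K] [InnerProductSpace ℂ K] [CompleteSpace K]
    (ρ : C(X, ℂ) →⋆ₐ[ℂ] (K →L[ℂ] K)) (π : C(X, Y)) (H : Subgroup Γ) :
    Submodule ℂ (L2 Γ K →L[ℂ] L2 Γ K) :=
  (Submodule.span ℂ
    {T | ∃ (f : C(Y, ℂ)) (h : H), T = sig Γ ρ (f.comp π) * lam (h : Γ)}).topologicalClosure

open Classical in
/-- The corner of an operator on `ℓ²(Γ, K)` at the identity of `Γ`: `v ↦ (T (δ_e ⊗ v))(e)`. -/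
def corner {Γ K : Type*} [Group Γ] [NormedAddCommGroup K] [InnerProductSpace ℂ K] :
    (L2 Γ K →L[ℂ] L2 Γ K) →L[ℂ] (K →L[ℂ] K) :=
  (ContinuousLinearMap.compL ℂ K (L2 Γ K) K (lp.evalCLM ℂ (fun _ : Γ => K) 2 1)).comp
    ((ContinuousLinearMap.compL ℂ K (L2 Γ K) (L2 Γ K)).flip
      (lp.singleContinuousLinearMap ℂ (fun _ : Γ => K) 2 1))

open Classical in
theorem corner_apply {Γ K : Type*} [Group Γ] [NormedAddCommGroup K] [InnerProductSpace ℂ K]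
    (T : L2 Γ K →L[ℂ] L2 Γ K) (v : K) :
    corner T v = T (lp.single (E := fun _ : Γ => K) 2 1 v) 1 := rfl

open Classical in
theorem corner_gen {Γ X K : Type*} [Group Γ] [TopologicalSpace X] [CompactSpace X]
    [MulAction Γ X] [ContinuousConstSMul Γ X]
    [NormedAddCommGroup K] [InnerProductSpace ℂ K] [CompleteSpace K]
    (ρ : C(X, ℂ) →⋆ₐ[ℂ] (K →L[ℂ] K)) (f : C(X, ℂ)) (s : Γ) :
    corner (sig Γ ρ f * lam s) = ρ (if s = 1 then f else 0) := by
  ext v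
  have hf : act (1 : Γ) f = f := by ext x; simp [act]
  by_cases h : s = 1
  · simp [corner_apply, h, hf]
  · have h' : (1 : Γ) ≠ s := fun e => h e.symm
    simp [corner_apply, h, hf]

/-- A faithful representation as a linear isometry. -/
def repIsometry {X K : Type*} [TopologicalSpace X] [CompactSpace X]
    [NormedAddCommGroup K] [InnerProductSpace ℂ K] [CompleteSpace K]
    (ρ : C(X, ℂ) →⋆ₐ[ℂ] (K →L[ℂ] K)) (hρ : Function.Injective ρ) :
    C(X, ℂ) →ₗᵢ[ℂ] (K →L[ℂ] K) where
  toLinearMap := ρ.toAlgHom.toLinearMap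
  norm_map' := fun f => NonUnitalStarAlgHom.norm_map ρ hρ f

theorem corner_mem {Γ X K : Type*} [Group Γ] [TopologicalSpace X] [CompactSpace X]
    [MulAction Γ X] [ContinuousConstSMul Γ X]
    [NormedAddCommGroup K] [InnerProductSpace ℂ K] [CompleteSpace K]
    (ρ : C(X, ℂ) →⋆ₐ[ℂ] (K →L[ℂ] K)) (hρ : Function.Injective ρ)
    (a : reduced Γ ρ) :
    corner (a : L2 Γ K →L[ℂ] L2 Γ K) ∈ LinearMap.range (repIsometry ρ hρ).toLinearMap := by
  have hcl : IsClosed ((LinearMap.range (repIsometry ρ hρ).toLinearMap : Submodule ℂ (K →L[ℂ] K)) :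
      Set (K →L[ℂ] K)) := by
    have h := (repIsometry ρ hρ).isometry.isClosedEmbedding.isClosed_range
    rwa [LinearMap.coe_range]
  have hle : reduced Γ ρ ≤ (LinearMap.range (repIsometry ρ hρ).toLinearMap).comap
      (corner (Γ := Γ) (K := K)).toLinearMap := by
    refine Submodule.topologicalClosure_minimal _ (Submodule.span_le.2 ?_)
      (hcl.preimage (corner (Γ := Γ) (K := K)).continuous)
    rintro _ ⟨f, s, rfl⟩
    classical
    exact ⟨if s = 1 then f else 0, (corner_gen ρ f s).symm⟩
  exact hle a.2

/-- The canonical conditional expectation `𝔼 : C(X) ⋊_r Γ → C(X)`. -/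
def condExp (Γ : Type*) {X K : Type*} [Group Γ] [TopologicalSpace X] [CompactSpace X]
    [MulAction Γ X] [ContinuousConstSMul Γ X]
    [NormedAddCommGroup K] [InnerProductSpace ℂ K] [CompleteSpace K]
    (ρ : C(X, ℂ) →⋆ₐ[ℂ] (K →L[ℂ] K)) (hρ : Function.Injective ρ) :
    reduced Γ ρ →L[ℂ] C(X, ℂ) :=
  ((repIsometry ρ hρ).equivRange.symm : _ →L[ℂ] C(X, ℂ)).comp
    ((corner.comp (reduced Γ ρ).subtypeL).codRestrict _ fun a => corner_mem ρ hρ a)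

/-- `𝔼(a)` is the function that acts as the corner of `a`. -/
theorem rep_condExp {Γ X K : Type*} [Group Γ] [TopologicalSpace X] [CompactSpace X]
    [MulAction Γ X] [ContinuousConstSMul Γ X]
    [NormedAddCommGroup K] [InnerProductSpace ℂ K] [CompleteSpace K]
    (ρ : C(X, ℂ) →⋆ₐ[ℂ] (K →L[ℂ] K)) (hρ : Function.Injective ρ) (a : reduced Γ ρ) :
    ρ (condExp Γ ρ hρ a) = corner (a : L2 Γ K →L[ℂ] L2 Γ K) :=
  congrArg Subtype.val ((repIsometry ρ hρ).equivRange.apply_symm_apply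
    ⟨corner (a : L2 Γ K →L[ℂ] L2 Γ K), corner_mem ρ hρ a⟩)

open Classical in
/-- `𝔼(σ(f) λ_s)` is `f` for `s = e` and `0` otherwise. -/
theorem condExp_gen {Γ X K : Type*} [Group Γ] [TopologicalSpace X] [CompactSpace X]
    [MulAction Γ X] [ContinuousConstSMul Γ X]
    [NormedAddCommGroup K] [InnerProductSpace ℂ K] [CompleteSpace K]
    (ρ : C(X, ℂ) →⋆ₐ[ℂ] (K →L[ℂ] K)) (hρ : Function.Injective ρ) (f : C(X, ℂ)) (s : Γ)
    (h : sig Γ ρ f * lam s ∈ reduced Γ ρ) :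
    condExp Γ ρ hρ ⟨sig Γ ρ f * lam s, h⟩ = if s = 1 then f else 0 :=
  hρ ((rep_condExp ρ hρ _).trans (corner_gen ρ f s))

/-- The canonical (atomic) representation of `C(X)` by multiplication operators on `ℓ²(X)`. -/
def pointRep (X : Type*) [TopologicalSpace X] [CompactSpace X] :
    C(X, ℂ) →⋆ₐ[ℂ] (L2 X ℂ →L[ℂ] L2 X ℂ) where
  toFun f := lp.mapCLM 2 (fun x : X => f x • ContinuousLinearMap.id ℂ ℂ) (norm_nonneg f)
    fun x => by simpa [norm_smul] using f.norm_coe_le_norm x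
  map_one' := by ext; simp
  map_mul' f g := by ext; simp [mul_assoc]
  map_zero' := by ext; simp
  map_add' f g := by ext; simp [add_mul]
  commutes' c := by ext; simp [Algebra.algebraMap_eq_smul_one]
  map_star' f := by
    rw [ContinuousLinearMap.star_eq_adjoint, ContinuousLinearMap.eq_adjoint_iff]
    intro ξ η
    simp only [lp.inner_eq_tsum]
    refine tsum_congr fun x => ?_
    simp
    ring

@[simp]
theorem pointRep_apply {X : Type*} [TopologicalSpace X] [CompactSpace X]
    (f : C(X, ℂ)) (ξ : L2 X ℂ) (x : X) : pointRep X f ξ x = f x * ξ x := rfl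

theorem pointRep_injective (X : Type*) [TopologicalSpace X] [CompactSpace X] :
    Function.Injective (pointRep X) := by
  classical
  intro f g h
  ext x
  have := congrArg (fun T : L2 X ℂ →L[ℂ] L2 X ℂ =>
    T (lp.single (E := fun _ : X => ℂ) 2 x 1) x) h
  simpa using this

open scoped ComplexOrder in
/-- A subgroup `H` of `Γ` is `Y`-plump, for a `Γ`-space `Y`: for every `ε > 0` and every
`a ∈ C(Y) ⋊_r Γ` there are `s₁, …, s_m ∈ H` and nonnegative `g₁, …, g_m ∈ C(Y)` with
`∑ g_j² = 1` such that `‖∑ g_j λ(s_j) a λ(s_j)* g_j - 𝔼(a)‖ < ε`. -/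
def IsPlump {Γ : Type*} [Group Γ] (Y : Type*) [TopologicalSpace Y] [CompactSpace Y]
    [MulAction Γ Y] [ContinuousConstSMul Γ Y] (H : Subgroup Γ) : Prop :=
  ∀ ε : ℝ, 0 < ε → ∀ a : reduced Γ (pointRep Y),
    ∃ (m : ℕ) (s : Fin m → H) (g : Fin m → C(Y, ℂ)),
      (∀ j, 0 ≤ g j) ∧ ∑ j, g j ^ 2 = 1 ∧
      ‖(∑ j, sig Γ (pointRep Y) (g j) * lam (s j : Γ) * (a : L2 Γ (L2 Y ℂ) →L[ℂ] L2 Γ (L2 Y ℂ)) *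
          star (lam (s j : Γ) : L2 Γ (L2 Y ℂ) →L[ℂ] L2 Γ (L2 Y ℂ)) * sig Γ (pointRep Y) (g j)) -
        sig Γ (pointRep Y) (condExp Γ (pointRep Y) (pointRep_injective Y) a)‖ < ε

end CrossedProduct

end

noncomputable section

namespace CrossedProduct

open scoped InnerProductSpace ComplexOrder

/-! Let `x ≠ 0` lie in an ideal of `𝒜`. The function `𝔼(x* x)` has value `‖x (δ_e ⊗ δ_z)‖²` at `z`,
so it is nonnegative and not zero. By minimality and compactness finitely many of its `H`-translates
add up to a strictly positive function. After scaling, the ideal contains some `b` with `‖1 - 𝔼(b)‖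
< 1` (`exists_norm_one_sub_condExp_lt`).

It remains to average away the off-diagonal part of `b` by unital contractions that preserve the
ideal. Plumpness does this only for coefficients in `C(Y)`, while those of `b` lie in `C(X)`. The
bridge is `norm_average_sum_le`: on each fibre `ℓ²(Γ) ⊗ δ_x` the average of `∑ σ(f_r) λ_r` is
dominated entrywise by a constant times the average of `∑ λ_r` over `π x`. The latter sum lies in
`C(Y) ⋊_r Γ` and has expectation zero if `e` does not occur, so plumpness makes its average small.

The resulting element of the ideal is at distance less than one from `1`, hence invertible in `𝒜`;
the ideal need not be closed. -/

section Action

variable {Γ X : Type*} [Group Γ] [TopologicalSpace X] [MulAction Γ X] [ContinuousConstSMul Γ X]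

theorem act_one (s : Γ) : act s (1 : C(X, ℂ)) = 1 := rfl

theorem act_zero (s : Γ) : act s (0 : C(X, ℂ)) = 0 := rfl

theorem act_add (s : Γ) (f g : C(X, ℂ)) : act s (f + g) = act s f + act s g := rfl

theorem act_sub (s : Γ) (f g : C(X, ℂ)) : act s (f - g) = act s f - act s g := rfl

theorem act_mul (s : Γ) (f g : C(X, ℂ)) : act s (f * g) = act s f * act s g := rfl

theorem act_smul (s : Γ) (c : ℂ) (f : C(X, ℂ)) : act s (c • f) = c • act s f := rfl

theorem act_star (s : Γ) (f : C(X, ℂ)) : act s (star f) = star (act s f) := rfl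

end Action

/-! ### Covariance relations and density of finite sums -/

section Operators

variable {Γ X K : Type*} [Group Γ] [NormedAddCommGroup K] [InnerProductSpace ℂ K]

theorem norm_sq_eq_tsum {ι : Type*} {F : ι → Type*} [∀ i, NormedAddCommGroup (F i)]
    (ξ : lp F 2) : ‖ξ‖ ^ 2 = ∑' i, ‖ξ i‖ ^ 2 := by
  have h := lp.norm_rpow_eq_tsum (p := 2) (by norm_num) ξ
  norm_num at h
  exact h

theorem summable_norm_sq {ι : Type*} {F : ι → Type*} [∀ i, NormedAddCommGroup (F i)]
    (ξ : lp F 2) : Summable fun i => ‖ξ i‖ ^ 2 := by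
  have h := (lp.memℓp ξ).summable (by norm_num)
  norm_num at h
  exact h

theorem lam_one : (lam (1 : Γ) : L2 Γ K →L[ℂ] L2 Γ K) = 1 := by
  ext ξ t
  simp

theorem lam_mul_lam (s t : Γ) : (lam s * lam t : L2 Γ K →L[ℂ] L2 Γ K) = lam (s * t) := by
  ext ξ r
  simp [mul_assoc]

variable [CompleteSpace K]

theorem star_lam (s : Γ) : star (lam s : L2 Γ K →L[ℂ] L2 Γ K) = lam s⁻¹ := by
  rw [ContinuousLinearMap.star_eq_adjoint, eq_comm, ContinuousLinearMap.eq_adjoint_iff]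
  intro ξ η
  rw [lp.inner_eq_tsum, lp.inner_eq_tsum, ← (Equiv.mulLeft s⁻¹).tsum_eq]
  simp

theorem lam_mul_star_lam (s : Γ) : (lam s * star (lam (K := K) s) : L2 Γ K →L[ℂ] L2 Γ K) = 1 := by
  rw [star_lam, lam_mul_lam, mul_inv_cancel, lam_one]

variable [TopologicalSpace X] [CompactSpace X] [MulAction Γ X] [ContinuousConstSMul Γ X]
  (ρ : C(X, ℂ) →⋆ₐ[ℂ] (K →L[ℂ] K))

theorem norm_sig_le (f : C(X, ℂ)) : ‖sig Γ ρ f‖ ≤ ‖f‖ :=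
  lp.norm_mapCLM_le ..

theorem sig_one : sig Γ ρ (1 : C(X, ℂ)) = 1 := by
  ext ξ t
  simp [act_one]

theorem sig_zero : sig Γ ρ (0 : C(X, ℂ)) = 0 := by
  ext ξ t
  simp [act_zero]

theorem sig_add (f g : C(X, ℂ)) : sig Γ ρ (f + g) = sig Γ ρ f + sig Γ ρ g := by
  ext ξ t
  simp [act_add]

theorem sig_sub (f g : C(X, ℂ)) : sig Γ ρ (f - g) = sig Γ ρ f - sig Γ ρ g := by
  ext ξ t
  simp [act_sub]

theorem sig_mul (f g : C(X, ℂ)) : sig Γ ρ (f * g) = sig Γ ρ f * sig Γ ρ g := by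
  ext ξ t
  simp [act_mul]

theorem sig_smul (c : ℂ) (f : C(X, ℂ)) : sig Γ ρ (c • f) = c • sig Γ ρ f := by
  ext ξ t
  simp [act_smul]

theorem sig_sum {ι : Type*} (F : Finset ι) (f : ι → C(X, ℂ)) :
    sig Γ ρ (∑ i ∈ F, f i) = ∑ i ∈ F, sig Γ ρ (f i) :=
  map_sum (AddMonoidHom.mk' (sig Γ ρ) (sig_add ρ)) f F

theorem star_sig (f : C(X, ℂ)) : star (sig Γ ρ f) = sig Γ ρ (star f) := by
  rw [ContinuousLinearMap.star_eq_adjoint, eq_comm, ContinuousLinearMap.eq_adjoint_iff]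
  intro ξ η
  rw [lp.inner_eq_tsum, lp.inner_eq_tsum]
  refine tsum_congr fun t => ?_
  rw [sig_apply, sig_apply, act_star, map_star, ContinuousLinearMap.star_eq_adjoint,
    ContinuousLinearMap.adjoint_inner_left]

/-- The finite sums `∑ σ(f_s) λ_s` are dense in the reduced crossed product. -/
theorem exists_finsupp_norm_sub_lt {a : L2 Γ K →L[ℂ] L2 Γ K} (ha : a ∈ reduced Γ ρ)
    {ε : ℝ} (hε : 0 < ε) :
    ∃ f : Γ →₀ C(X, ℂ), ‖a - f.sum fun s h => sig Γ ρ h * lam s‖ < ε := by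
  obtain ⟨c, hc, hac⟩ := Metric.mem_closure_iff.1 ha ε hε
  suffices h : ∃ f : Γ →₀ C(X, ℂ), c = f.sum fun s h => sig Γ ρ h * lam s by
    obtain ⟨f, rfl⟩ := h
    exact ⟨f, by rwa [← dist_eq_norm]⟩
  clear hac
  induction hc using Submodule.span_induction with
  | mem x hx =>
    obtain ⟨f, s, rfl⟩ := hx
    exact ⟨Finsupp.single s f, by rw [Finsupp.sum_single_index]; simp [sig_zero]⟩
  | zero => exact ⟨0, by simp⟩
  | add x y _ _ hx hy =>
    obtain ⟨f, rfl⟩ := hx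
    obtain ⟨g, rfl⟩ := hy
    exact ⟨f + g, (Finsupp.sum_add_index' (by simp [sig_zero])
      (by simp [sig_add, add_mul])).symm⟩
  | smul c x _ hx =>
    obtain ⟨f, rfl⟩ := hx
    refine ⟨c • f, ?_⟩
    rw [Finsupp.sum_smul_index' (by simp [sig_zero]), Finsupp.smul_sum]
    simp [sig_smul]

theorem sig_mul_lam_mem_reduced (f : C(X, ℂ)) (s : Γ) : sig Γ ρ f * lam s ∈ reduced Γ ρ :=
  Submodule.le_topologicalClosure _ (Submodule.subset_span ⟨f, s, rfl⟩)

theorem lam_mem_reduced (s : Γ) : lam s ∈ reduced Γ ρ := by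
  simpa [sig_one] using sig_mul_lam_mem_reduced ρ 1 s

/-- `‖∑ A_j* T A_j‖ ≤ ‖T‖` whenever `∑ A_j* A_j = 1`. -/
theorem norm_sum_star_mul_mul_le {ι : Type*} [Fintype ι] (A : ι → K →L[ℂ] K)
    (hA : ∑ j, star (A j) * A j = 1) (T : K →L[ℂ] K) :
    ‖∑ j, star (A j) * T * A j‖ ≤ ‖T‖ := by
  have hinner (j : ι) (v w : K) : ⟪star (A j) v, w⟫_ℂ = ⟪v, A j w⟫_ℂ := by
    rw [ContinuousLinearMap.star_eq_adjoint, ContinuousLinearMap.adjoint_inner_left]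
  have hsq (v : K) : ∑ j, ‖A j v‖ ^ 2 = ‖v‖ ^ 2 := by
    have hv : ∑ j, star (A j) (A j v) = v := by
      have h := congrArg (fun S : K →L[ℂ] K => S v) hA
      rwa [sum_apply] at h
    have h : ⟪∑ j, star (A j) (A j v), v⟫_ℂ = ⟪v, v⟫_ℂ := by rw [hv]
    simp only [sum_inner, hinner, inner_self_eq_norm_sq_to_K] at h
    exact_mod_cast h
  refine ContinuousLinearMap.opNorm_le_of_re_inner_le (norm_nonneg _) fun v w hv hw => ?_
  have hexp : (∑ j, star (A j) * T * A j) v = ∑ j, star (A j) (T (A j v)) := by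
    rw [sum_apply]
    rfl
  rw [hexp, sum_inner, map_sum]
  calc
    -- Cauchy–Schwarz and AM–GM in each summand; the squares then add up by `hsq`, since `v ↦ (A_j
    -- v)_j` is isometric.
    _ ≤ ∑ j, ‖T‖ * ((‖A j v‖ ^ 2 + ‖A j w‖ ^ 2) / 2) := by
      refine Finset.sum_le_sum fun j _ => ?_
      rw [hinner]
      refine (re_inner_le_norm _ _).trans ((mul_le_mul_of_nonneg_right (T.le_opNorm _)
        (norm_nonneg _)).trans ?_)
      rw [mul_assoc]
      gcongr
      linarith [two_mul_le_add_sq ‖A j v‖ ‖A j w‖]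
    _ = ‖T‖ := by
      rw [← Finset.mul_sum, ← Finset.sum_div, Finset.sum_add_distrib, hsq, hsq, hv, hw]
      norm_num

end Operators

theorem star_eq_of_nonneg {X : Type*} [TopologicalSpace X] {g : C(X, ℂ)} (hg : 0 ≤ g) : star g = g := by
  ext x
  exact (Complex.conj_eq_iff_im.2 (Complex.nonneg_iff.1 (hg x)).2.symm)

/-! ### Averaging maps as unital contractions -/

section Averaging

variable {Γ X K ι : Type*} [Group Γ] [TopologicalSpace X] [CompactSpace X]
  [MulAction Γ X] [ContinuousConstSMul Γ X]
  [NormedAddCommGroup K] [InnerProductSpace ℂ K] [CompleteSpace K] [Fintype ι]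
  (ρ : C(X, ℂ) →⋆ₐ[ℂ] (K →L[ℂ] K))

/-- The averaging map `T ↦ ∑ g_j λ(s_j) T λ(s_j)* g_j`. -/
def average (s : ι → Γ) (g : ι → C(X, ℂ)) :
    (L2 Γ K →L[ℂ] L2 Γ K) →ₗ[ℂ] (L2 Γ K →L[ℂ] L2 Γ K) where
  toFun T := ∑ j, sig Γ ρ (g j) * lam (s j) * T * star (lam (K := K) (s j)) * sig Γ ρ (g j)
  map_add' S T := by simp only [mul_add, add_mul, Finset.sum_add_distrib]
  map_smul' c T := by
    simp only [mul_smul_comm, smul_mul_assoc, ← Finset.smul_sum, RingHom.id_apply]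

theorem average_apply (s : ι → Γ) (g : ι → C(X, ℂ)) (T : L2 Γ K →L[ℂ] L2 Γ K) :
    average ρ s g T = ∑ j, sig Γ ρ (g j) * lam (s j) * T * star (lam (K := K) (s j)) * sig Γ ρ (g j) := rfl

variable {s : ι → Γ} {g : ι → C(X, ℂ)}

theorem average_one (hsum : ∑ j, g j ^ 2 = 1) : average ρ s g 1 = 1 := by
  have h (j : ι) : sig Γ ρ (g j) * lam (s j) * 1 * star (lam (K := K) (s j)) * sig Γ ρ (g j) =
      sig Γ ρ (g j ^ 2) := by
    rw [mul_one, mul_assoc (sig Γ ρ (g j)), lam_mul_star_lam, mul_one, pow_two, sig_mul]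
  rw [average_apply, Finset.sum_congr rfl fun j _ => h j, ← sig_sum, hsum, sig_one]

/-- With `A_j = λ(s_j)* σ(g_j)` the average is `∑ A_j* T A_j`, because nonnegative functions are
self-adjoint. -/
theorem norm_average_le (hg : ∀ j, 0 ≤ g j) (hsum : ∑ j, g j ^ 2 = 1)
    (T : L2 Γ K →L[ℂ] L2 Γ K) : ‖average ρ s g T‖ ≤ ‖T‖ := by
  have hstar (j : ι) : star (star (lam (K := K) (s j)) * sig Γ ρ (g j)) = sig Γ ρ (g j) * lam (s j) := by
    rw [star_mul, star_star, star_sig, star_eq_of_nonneg (hg j)]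
  have h := norm_sum_star_mul_mul_le (fun j => star (lam (K := K) (s j)) * sig Γ ρ (g j)) (by
    rw [← average_one ρ hsum (s := s), average_apply]
    refine Finset.sum_congr rfl fun j _ => ?_
    rw [hstar, mul_one]
    simp only [mul_assoc]) T
  rw [average_apply]
  simp only [hstar, mul_assoc] at h ⊢
  exact h

end Averaging

/-! ### Fibrewise domination of operators -/

section Fibres

theorem sum_apply_apply {ι Γ X : Type*} (F : Finset ι) (T : ι → L2 Γ (L2 X ℂ) →L[ℂ] L2 Γ (L2 X ℂ))
    (ξ : L2 Γ (L2 X ℂ)) (t : Γ) (x : X) : (∑ i ∈ F, T i) ξ t x = ∑ i ∈ F, T i ξ t x := by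
  classical
  induction F using Finset.induction_on with
  | empty => simp
  | insert i F hi h => rw [Finset.sum_insert hi, Finset.sum_insert hi, ← h]; rfl

variable {Γ X Y : Type*}

theorem summable_fibre (ξ : L2 Γ (L2 X ℂ)) :
    Summable fun p : Γ × X => ‖ξ p.1 p.2‖ ^ 2 := by
  rw [summable_prod_of_nonneg fun _ => by positivity]
  exact ⟨fun t => summable_norm_sq (ξ t), by
    simpa only [← norm_sq_eq_tsum] using summable_norm_sq ξ⟩

theorem norm_sq_eq_tsum_fibre (ξ : L2 Γ (L2 X ℂ)) : ‖ξ‖ ^ 2 = ∑' x, ∑' t, ‖ξ t x‖ ^ 2 := by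
  rw [norm_sq_eq_tsum]
  simp only [norm_sq_eq_tsum]
  exact (Summable.tsum_comm (f := fun t x => ‖ξ t x‖ ^ 2) (summable_fibre ξ)).symm

open Classical in
/-- The absolute values of `ξ` on the fibre over `x`, placed over the point `y`. -/
def absFibre (ξ : L2 Γ (L2 X ℂ)) (x : X) (y : Y) : L2 Γ (L2 Y ℂ) :=
  ⟨fun t => lp.single (E := fun _ : Y => ℂ) 2 y (‖ξ t x‖ : ℂ), memℓp_gen (by
    have h := (summable_fibre ξ).prod_symm.prod_factor x
    simpa [lp.norm_single] using h)⟩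

theorem absFibre_apply (ξ : L2 Γ (L2 X ℂ)) (x : X) (y : Y) (t : Γ) :
    absFibre ξ x y t y = ‖ξ t x‖ := by
  simp [absFibre]

theorem norm_absFibre_sq (ξ : L2 Γ (L2 X ℂ)) (x : X) (y : Y) :
    ‖absFibre ξ x y‖ ^ 2 = ∑' t, ‖ξ t x‖ ^ 2 := by
  rw [norm_sq_eq_tsum]
  refine tsum_congr fun t => ?_
  simp [absFibre, lp.norm_single]

/-- An operator on `ℓ²(Γ × X)` is bounded by an operator on `ℓ²(Γ × Y)` that dominates it on every
fibre. -/
theorem norm_le_mul_norm_of_fibrewise (S : L2 Γ (L2 X ℂ) →L[ℂ] L2 Γ (L2 X ℂ))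
    (T : L2 Γ (L2 Y ℂ) →L[ℂ] L2 Γ (L2 Y ℂ)) {C : ℝ} (hC : 0 ≤ C) (p : X → Y)
    (h : ∀ ξ x t, ‖S ξ t x‖ ≤ C * ‖T (absFibre ξ x (p x)) t (p x)‖) : ‖S‖ ≤ C * ‖T‖ := by
  refine S.opNorm_le_bound (by positivity) fun ξ => ?_
  refine le_of_sq_le_sq ?_ (by positivity)
  have hs (η : L2 Γ (L2 X ℂ)) : Summable fun x => ∑' t, ‖η t x‖ ^ 2 :=
    (summable_fibre η).prod_symm.prod
  rw [mul_pow, norm_sq_eq_tsum_fibre, norm_sq_eq_tsum_fibre, ← tsum_mul_left]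
  refine (hs _).tsum_le_tsum (fun x => ?_) ((hs ξ).mul_left _)
  have hT : Summable fun t => ‖T (absFibre ξ x (p x)) t‖ ^ 2 := summable_norm_sq _
  calc
    ∑' t, ‖S ξ t x‖ ^ 2 ≤ ∑' t, C ^ 2 * ‖T (absFibre ξ x (p x)) t‖ ^ 2 := by
      refine ((summable_fibre (S ξ)).prod_symm.prod_factor x).tsum_le_tsum (fun t => ?_)
        (hT.mul_left _)
      dsimp only [Prod.swap]
      rw [← mul_pow]
      gcongr
      refine (h ξ x t).trans ?_
      gcongr
      -- Only the coordinate over `p x` is used; the others can be dropped.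
      exact lp.norm_apply_le_norm (by norm_num) _ _
    _ = C ^ 2 * ‖T (absFibre ξ x (p x))‖ ^ 2 := by rw [tsum_mul_left, ← norm_sq_eq_tsum]
    _ ≤ C ^ 2 * (‖T‖ * ‖absFibre ξ x (p x)‖) ^ 2 := by
      gcongr
      exact T.le_opNorm _
    _ = (C * ‖T‖) ^ 2 * ∑' t, ‖ξ t x‖ ^ 2 := by rw [mul_pow, norm_absFibre_sq]; ring

end Fibres

/-! ### Comparison of averages over `X` and over `Y` -/

section PointRep

variable {Γ X Y : Type*} [Group Γ] [TopologicalSpace X] [CompactSpace X]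
  [MulAction Γ X] [ContinuousConstSMul Γ X] [TopologicalSpace Y] [CompactSpace Y]
  [MulAction Γ Y] [ContinuousConstSMul Γ Y]

theorem sig_pointRep_apply (f : C(X, ℂ)) (ξ : L2 Γ (L2 X ℂ)) (t : Γ) (x : X) :
    sig Γ (pointRep X) f ξ t x = f (t • x) * ξ t x := by
  simp [act]

theorem average_apply_apply {ι : Type*} [Fintype ι] (s : ι → Γ) (g : ι → C(X, ℂ))
    (T : L2 Γ (L2 X ℂ) →L[ℂ] L2 Γ (L2 X ℂ)) (ξ : L2 Γ (L2 X ℂ)) (t : Γ) (x : X) :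
    average (pointRep X) s g T ξ t x = ∑ j, g j (t • x) *
      T (lam (s j)⁻¹ (sig Γ (pointRep X) (g j) ξ)) ((s j)⁻¹ * t) x := by
  rw [average_apply, sum_apply_apply]
  refine Finset.sum_congr rfl fun j _ => ?_
  rw [star_lam]
  exact sig_pointRep_apply ..

/-- All operators involved are diagonal in the `X`-coordinate. By equivariance the weights `g_j ∘ π`
on the fibre over `x` equal the weights `g_j` over `π x`, and each `f r` contributes a factor of
modulus at most `C`. Since the `g_j` are nonnegative, nothing cancels on the `Y` side, so the
triangle inequality gives the domination. -/
theorem norm_average_sum_le (π : C(X, Y)) (hequiv : ∀ (s : Γ) (x : X), π (s • x) = s • π x)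
    {ι : Type*} [Fintype ι] (s : ι → Γ) {g : ι → C(Y, ℂ)} (hg : ∀ j, 0 ≤ g j)
    (F : Finset Γ) (f : Γ → C(X, ℂ)) {C : ℝ} (hC : 0 ≤ C) (hf : ∀ r ∈ F, ‖f r‖ ≤ C) :
    ‖average (pointRep X) s (fun j => (g j).comp π) (∑ r ∈ F, sig Γ (pointRep X) (f r) * lam r)‖ ≤
      C * ‖average (pointRep Y) s g (∑ r ∈ F, lam r)‖ := by
  refine norm_le_mul_norm_of_fibrewise _ _ hC π fun ξ x t => ?_
  have hgn (j : ι) (y : Y) : g j y = (‖g j y‖ : ℂ) := by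
    exact (RCLike.norm_of_nonneg' (hg j y)).symm
  -- On absolute values the `Y`-average is a sum of nonnegative reals, so its norm can be compared
  -- term by term.
  have hY : average (pointRep Y) s g (∑ r ∈ F, lam r) (absFibre ξ x (π x)) t (π x) =
      ((∑ j, ‖g j (t • π x)‖ * ∑ r ∈ F, ‖g j ((s j * (r⁻¹ * ((s j)⁻¹ * t))) • π x)‖ *
        ‖ξ (s j * (r⁻¹ * ((s j)⁻¹ * t))) x‖ : ℝ) : ℂ) := by
    rw [average_apply_apply]
    simp only [Complex.ofReal_sum, Complex.ofReal_mul]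
    refine Finset.sum_congr rfl fun j _ => ?_
    rw [sum_apply_apply, ← hgn]
    congr 1
    refine Finset.sum_congr rfl fun r _ => ?_
    rw [← hgn, lam_apply, lam_apply, sig_pointRep_apply, absFibre_apply, inv_inv]
  rw [hY, Complex.norm_real, Real.norm_of_nonneg (by positivity), average_apply_apply,
    Finset.mul_sum]
  refine norm_sum_le_of_le _ fun j _ => ?_
  rw [sum_apply_apply, norm_mul, mul_left_comm, Finset.mul_sum, ContinuousMap.comp_apply, hequiv]
  gcongr
  refine norm_sum_le_of_le _ fun r hr => ?_
  have h : (sig Γ (pointRep X) (f r) * lam r : L2 Γ (L2 X ℂ) →L[ℂ] L2 Γ (L2 X ℂ))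
      (lam (s j)⁻¹ (sig Γ (pointRep X) ((g j).comp π) ξ)) ((s j)⁻¹ * t) x =
      f r (((s j)⁻¹ * t) • x) * (g j ((s j * (r⁻¹ * ((s j)⁻¹ * t))) • π x) *
        ξ (s j * (r⁻¹ * ((s j)⁻¹ * t))) x) := by
    refine (sig_pointRep_apply (f r) (lam r (lam (s j)⁻¹
      (sig Γ (pointRep X) ((g j).comp π) ξ))) _ _).trans ?_
    rw [lam_apply, lam_apply, sig_pointRep_apply, inv_inv, ContinuousMap.comp_apply, hequiv]
  rw [h, norm_mul, norm_mul]
  gcongr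
  exact ((f r).norm_coe_le_norm _).trans (hf r hr)

end PointRep

/-! ### Basis vectors and matrix entries -/

section Basis

variable {Γ X : Type*}

open Classical in
/-- The basis vector `δ_t ⊗ δ_x` of `ℓ²(Γ, ℓ²(X))`. -/
def basisVec (t : Γ) (x : X) : L2 Γ (L2 X ℂ) :=
  lp.single (E := fun _ : Γ => L2 X ℂ) 2 t (lp.single (E := fun _ : X => ℂ) 2 x 1)

open Classical in
theorem basisVec_apply (t r : Γ) (x z : X) :
    basisVec t x r z = if r = t ∧ z = x then 1 else 0 := by
  by_cases hr : r = t
  · subst hr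
    by_cases hz : z = x
    · subst hz
      simp [basisVec]
    · simp [basisVec, hz]
  · simp [basisVec, hr]

open Classical in
theorem inner_basisVec_left (t : Γ) (x : X) (ξ : L2 Γ (L2 X ℂ)) :
    ⟪basisVec t x, ξ⟫_ℂ = ξ t x := by
  rw [basisVec, lp.inner_single_left, lp.inner_single_left]
  simp

theorem norm_apply_apply_le (ξ : L2 Γ (L2 X ℂ)) (t : Γ) (x : X) : ‖ξ t x‖ ≤ ‖ξ‖ :=
  (lp.norm_apply_le_norm (by norm_num) (ξ t) x).trans (lp.norm_apply_le_norm (by norm_num) ξ t)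

theorem norm_basisVec (t : Γ) (x : X) : ‖basisVec t x‖ = 1 := by
  simp [basisVec, lp.norm_single]

theorem eq_zero_of_apply_basisVec {T : L2 Γ (L2 X ℂ) →L[ℂ] L2 Γ (L2 X ℂ)}
    (h : ∀ t x, T (basisVec t x) = 0) : T = 0 := by
  classical
  refine lp.ext_continuousLinearMap (by norm_num) fun t => ?_
  refine lp.ext_continuousLinearMap (by norm_num) fun x => ?_
  refine ContinuousLinearMap.ext_ring ?_
  refine Eq.trans ?_ (h t x)
  simp only [ContinuousLinearMap.comp_apply, lp.singleContinuousLinearMap_apply, basisVec]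

theorem star_mul_self_basisVec (T : L2 Γ (L2 X ℂ) →L[ℂ] L2 Γ (L2 X ℂ)) (t : Γ) (x : X) :
    (star T * T) (basisVec t x) t x = ((‖T (basisVec t x)‖ ^ 2 : ℝ) : ℂ) := by
  rw [← inner_basisVec_left, ContinuousLinearMap.star_eq_adjoint, Complex.ofReal_pow]
  exact (ContinuousLinearMap.adjoint_inner_right T _ _).trans
    (inner_self_eq_norm_sq_to_K (𝕜 := ℂ) (T (basisVec t x)))

/-- The linear functional `T ↦ (T ξ)(t)(x)`. -/
def entry (ξ : L2 Γ (L2 X ℂ)) (t : Γ) (x : X) : (L2 Γ (L2 X ℂ) →L[ℂ] L2 Γ (L2 X ℂ)) →L[ℂ] ℂ :=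
  (lp.evalCLM ℂ (fun _ : X => ℂ) 2 x).comp ((lp.evalCLM ℂ (fun _ : Γ => L2 X ℂ) 2 t).comp
    (ContinuousLinearMap.apply ℂ (L2 Γ (L2 X ℂ)) ξ))

theorem entry_apply (ξ : L2 Γ (L2 X ℂ)) (t : Γ) (x : X)
    (T : L2 Γ (L2 X ℂ) →L[ℂ] L2 Γ (L2 X ℂ)) : entry ξ t x T = T ξ t x := rfl

variable [Group Γ]

theorem lam_basisVec (s t : Γ) (x : X) : lam s (basisVec t x) = basisVec (s * t) x := by
  ext r z
  rw [lam_apply, basisVec_apply, basisVec_apply, inv_mul_eq_iff_eq_mul]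

end Basis

/-! ### The expectation on matrix entries, and its use with plumpness and minimality -/

section Expectation

variable {Γ X : Type*} [Group Γ] [TopologicalSpace X] [CompactSpace X]
  [MulAction Γ X] [ContinuousConstSMul Γ X]

/-- The crossed product commutes with the unitary `δ_r ⊗ δ_z ↦ δ_{r t⁻¹} ⊗ δ_{t z}`. Hence an
element is determined by its columns at `e`. -/
theorem entry_basisVec_eq {a : L2 Γ (L2 X ℂ) →L[ℂ] L2 Γ (L2 X ℂ)}
    (ha : a ∈ reduced Γ (pointRep X)) (t r : Γ) (x z : X) :
    a (basisVec t x) r z = a (basisVec 1 (t • x)) (r * t⁻¹) (t • z) := by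
  have hle : reduced Γ (pointRep X) ≤ LinearMap.eqLocus (entry (basisVec t x) r z).toLinearMap
      (entry (basisVec 1 (t • x)) (r * t⁻¹) (t • z)).toLinearMap := by
    refine Submodule.topologicalClosure_minimal _ (Submodule.span_le.2 ?_)
      (isClosed_eq (entry _ _ _).continuous (entry _ _ _).continuous)
    rintro _ ⟨f, s, rfl⟩
    change sig Γ (pointRep X) f (lam s (basisVec t x)) r z =
      sig Γ (pointRep X) f (lam s (basisVec 1 (t • x))) (r * t⁻¹) (t • z)
    rw [sig_pointRep_apply, sig_pointRep_apply, lam_basisVec, lam_basisVec, basisVec_apply,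
      basisVec_apply]
    rw [smul_smul, inv_mul_cancel_right]
    have h : (r * t⁻¹ = s * 1 ∧ t • z = t • x) ↔ (r = s * t ∧ z = x) := by
      rw [mul_one, mul_inv_eq_iff_eq_mul, smul_left_cancel_iff]
    by_cases hp : r = s * t ∧ z = x
    · rw [if_pos hp, if_pos (h.2 hp)]
    · rw [if_neg hp, if_neg (mt h.1 hp)]
  exact hle ha

theorem condExp_apply (a : reduced Γ (pointRep X)) (z : X) :
    condExp Γ (pointRep X) (pointRep_injective X) a z =
      (a : L2 Γ (L2 X ℂ) →L[ℂ] L2 Γ (L2 X ℂ)) (basisVec 1 z) 1 z := by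
  classical
  have h := congrArg (fun T : L2 X ℂ →L[ℂ] L2 X ℂ => T (lp.single (E := fun _ : X => ℂ) 2 z 1) z)
    (rep_condExp (pointRep X) (pointRep_injective X) a)
  rw [corner_apply, pointRep_apply, lp.single_apply_self, mul_one] at h
  rw [h, basisVec]

/-- In terms of diagonal entries: `𝔼` is equivariant, so conjugating by `λ_s` translates the
expectation. -/
theorem condExp_lam_conj {a : L2 Γ (L2 X ℂ) →L[ℂ] L2 Γ (L2 X ℂ)}
    (ha : a ∈ reduced Γ (pointRep X)) (s : Γ) (z : X) :
    (lam (K := L2 X ℂ) s * a * star (lam (K := L2 X ℂ) s)) (basisVec 1 z) 1 z =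
      a (basisVec 1 (s⁻¹ • z)) 1 (s⁻¹ • z) := by
  rw [star_lam]
  change a (lam s⁻¹ (basisVec 1 z)) (s⁻¹ * 1) z = _
  rw [lam_basisVec, entry_basisVec_eq ha]
  simp

/-- Together with `star_mul_self_basisVec` this is the faithfulness of `𝔼`. -/
theorem exists_apply_basisVec_one_ne_zero {a : L2 Γ (L2 X ℂ) →L[ℂ] L2 Γ (L2 X ℂ)}
    (ha : a ∈ reduced Γ (pointRep X)) (h : a ≠ 0) : ∃ x : X, a (basisVec 1 x) ≠ 0 := by
  by_contra! h0
  refine h (eq_zero_of_apply_basisVec fun t x => ?_)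
  ext r z
  rw [entry_basisVec_eq ha, h0]
  rfl

variable {Y : Type*} [TopologicalSpace Y] [CompactSpace Y] [MulAction Γ Y]
  [ContinuousConstSMul Γ Y]

/-- Plumpness over `Y` allows averaging the off-diagonal part of a finite sum with coefficients
in `C(X)` to something small. -/
theorem IsPlump.exists_norm_average_sum_lt {H : Subgroup Γ} (hH : IsPlump Y H) (π : C(X, Y))
    (hequiv : ∀ (s : Γ) (x : X), π (s • x) = s • π x) (F : Finset Γ) (hF : 1 ∉ F)
    (f : Γ → C(X, ℂ)) {ε : ℝ} (hε : 0 < ε) :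
    ∃ (m : ℕ) (s : Fin m → H) (g : Fin m → C(Y, ℂ)), (∀ j, 0 ≤ g j) ∧ ∑ j, g j ^ 2 = 1 ∧
      ‖average (pointRep X) (fun j => (s j : Γ)) (fun j => (g j).comp π)
        (∑ r ∈ F, sig Γ (pointRep X) (f r) * lam r)‖ < ε := by
  set C : ℝ := ∑ r ∈ F, ‖f r‖
  have hC : 0 ≤ C := Finset.sum_nonneg fun _ _ => norm_nonneg _
  have hmem : (∑ r ∈ F, lam r) ∈ reduced Γ (pointRep Y) :=
    Submodule.sum_mem _ fun r _ => lam_mem_reduced _ r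
  have hE : condExp Γ (pointRep Y) (pointRep_injective Y) ⟨_, hmem⟩ = 0 := by
    classical
    refine pointRep_injective Y ((rep_condExp ..).trans ?_)
    rw [map_sum, map_zero]
    refine Finset.sum_eq_zero fun r hr => ?_
    have h := corner_gen (pointRep Y) 1 r
    rwa [sig_one, one_mul, if_neg (by rintro rfl; exact hF hr), map_zero] at h
  -- `C + 1` rather than `C`, since `C` may vanish.
  obtain ⟨m, s, g, hg, hsum, h⟩ := hH (ε / (C + 1)) (by positivity) ⟨_, hmem⟩
  rw [hE, sig_zero, sub_zero] at h
  refine ⟨m, s, g, hg, hsum, (norm_average_sum_le π hequiv (fun j => (s j : Γ)) hg F f hC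
    fun r hr => Finset.single_le_sum (f := fun r => ‖f r‖)
      (fun _ _ => norm_nonneg _) hr).trans_lt ?_⟩
  rw [lt_div_iff₀ (by positivity)] at h
  refine lt_of_le_of_lt ?_ h
  rw [average_apply, mul_comm]
  gcongr
  linarith

/-- If `‖1 - 𝔼(b)‖ < 1`, then some average of `b` is at distance less than one from `1`. -/
theorem IsPlump.exists_norm_one_sub_average_lt {H : Subgroup Γ} (hH : IsPlump Y H) (π : C(X, Y))
    (hequiv : ∀ (s : Γ) (x : X), π (s • x) = s • π x) (b : reduced Γ (pointRep X))
    (hb : ‖1 - condExp Γ (pointRep X) (pointRep_injective X) b‖ < 1) :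
    ∃ (m : ℕ) (s : Fin m → H) (g : Fin m → C(Y, ℂ)),
      ‖1 - average (pointRep X) (fun j => (s j : Γ)) (fun j => (g j).comp π)
        (b : L2 Γ (L2 X ℂ) →L[ℂ] L2 Γ (L2 X ℂ))‖ < 1 := by
  classical
  set e := condExp Γ (pointRep X) (pointRep_injective X) b with he
  -- Three errors of size `ε` are added to `‖1 - e‖`: the approximation of `b`, its effect on the
  -- expectation, and the averaged off-diagonal part.
  set ε := (1 - ‖1 - e‖) / 3 with hε_def
  have hε : 0 < ε := by rw [hε_def]; linarith
  obtain ⟨f, hf⟩ := exists_finsupp_norm_sub_lt (pointRep X) b.2 hε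
  set c : L2 Γ (L2 X ℂ) →L[ℂ] L2 Γ (L2 X ℂ) := f.sum fun s h => sig Γ (pointRep X) h * lam s
  have hc : c = sig Γ (pointRep X) (f 1) +
      ∑ r ∈ f.support.erase 1, sig Γ (pointRep X) (f r) * lam r := by
    -- Adding `1` to the support lets `f 1` be split off even when it is zero.
    have h := Finsupp.sum_of_support_subset f (Finset.subset_insert 1 f.support)
      (fun s h => (sig Γ (pointRep X) h * lam s : L2 Γ (L2 X ℂ) →L[ℂ] L2 Γ (L2 X ℂ)))
      (by simp [sig_zero])
    rw [← Finset.add_sum_erase _ _ (Finset.mem_insert_self 1 f.support),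
      Finset.erase_insert_eq_erase, lam_one,
      mul_one] at h
    exact h
  obtain ⟨m, s, g, hg, hsum, h⟩ := hH.exists_norm_average_sum_lt π hequiv (f.support.erase 1)
    (Finset.notMem_erase _ _) f hε
  refine ⟨m, s, g, ?_⟩
  have hg' (j : Fin m) : 0 ≤ (g j).comp π := fun x => hg j (π x)
  have hsum' : ∑ j, (g j).comp π ^ 2 = 1 := by
    ext x
    simpa using congrArg (fun q : C(Y, ℂ) => q (π x)) hsum
  -- Pointwise, `e - f 1` is a diagonal entry of `b - c`, so it is bounded by `‖b - c‖`.
  have hef : ‖e - f 1‖ ≤ ε := by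
    refine (ContinuousMap.norm_le _ hε.le).2 fun z => ?_
    have hcz : c (basisVec 1 z) 1 z = f 1 z := by
      have hmem : c ∈ reduced Γ (pointRep X) :=
        Submodule.sum_mem _ fun r _ => sig_mul_lam_mem_reduced _ _ r
      rw [hc, ← entry_apply, map_add, map_sum, entry_apply, sig_pointRep_apply, basisVec_apply,
        Finset.sum_eq_zero]
      · simp
      · intro r hr
        rw [entry_apply]
        refine (sig_pointRep_apply (f r) (lam r (basisVec 1 z)) 1 z).trans ?_
        rw [lam_basisVec, basisVec_apply, if_neg, mul_zero]
        rintro ⟨h1, -⟩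
        exact Finset.ne_of_mem_erase hr (by simpa using h1.symm)
    have hez : e z - f 1 z = ((b : L2 Γ (L2 X ℂ) →L[ℂ] L2 Γ (L2 X ℂ)) - c) (basisVec 1 z) 1 z := by
      rw [he, condExp_apply, ← hcz]
      rfl
    rw [ContinuousMap.sub_apply, hez]
    refine (norm_apply_apply_le _ _ _).trans ((ContinuousLinearMap.le_opNorm _ _).trans ?_)
    rw [norm_basisVec, mul_one]
    exact hf.le
  set φ := average (pointRep X) (fun j => (s j : Γ)) (fun j => (g j).comp π)
  have hφ (T : L2 Γ (L2 X ℂ) →L[ℂ] L2 Γ (L2 X ℂ)) : ‖φ T‖ ≤ ‖T‖ :=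
    norm_average_le _ hg' hsum' T
  have hdec : 1 - φ b = φ (sig Γ (pointRep X) (1 - e)) + φ (sig Γ (pointRep X) (e - f 1)) -
      φ (b - c) - φ (∑ r ∈ f.support.erase 1, sig Γ (pointRep X) (f r) * lam r) := by
    have h1 : φ 1 = 1 := average_one _ hsum'
    rw [← h1, ← map_sub, ← map_add, ← map_sub, ← map_sub]
    congr 1
    rw [hc, sig_sub, sig_sub, sig_one]
    abel
  rw [hdec]
  have h1 := (hφ (sig Γ (pointRep X) (1 - e))).trans (norm_sig_le _ _)
  have h2 := (hφ (sig Γ (pointRep X) (e - f 1))).trans ((norm_sig_le _ _).trans hef)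
  have h3 := (hφ (b - c)).trans_lt hf
  refine (norm_sub_le _ _).trans_lt ?_
  have h4 := norm_sub_le (φ (sig Γ (pointRep X) (1 - e)) + φ (sig Γ (pointRep X) (e - f 1)))
    (φ (b - c))
  have h5 := norm_add_le (φ (sig Γ (pointRep X) (1 - e))) (φ (sig Γ (pointRep X) (e - f 1)))
  linarith

/-- Over a minimal action, a nonzero `x` has a positive combination of conjugates of `x* x` whose
expectation is at distance less than one from `1`. -/
theorem exists_norm_one_sub_condExp_lt [Nonempty X] (H : Subgroup Γ)
    (hmin : MulAction.IsMinimal H X)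
    {x : L2 Γ (L2 X ℂ) →L[ℂ] L2 Γ (L2 X ℂ)} (hx : x ∈ reduced Γ (pointRep X)) (hx0 : x ≠ 0)
    (hxx : star x * x ∈ reduced Γ (pointRep X)) :
    ∃ (F : Finset H) (c : ℂ), ∀ hb : c • ∑ h ∈ F, lam (h : Γ) * (star x * x) *
        star (lam (K := L2 X ℂ) (h : Γ)) ∈ reduced Γ (pointRep X),
      ‖1 - condExp Γ (pointRep X) (pointRep_injective X) ⟨_, hb⟩‖ < 1 := by
  set e := condExp Γ (pointRep X) (pointRep_injective X) ⟨_, hxx⟩ with he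
  have hez (z : X) : e z = ((‖x (basisVec 1 z)‖ ^ 2 : ℝ) : ℂ) := by
    rw [he, condExp_apply]
    exact star_mul_self_basisVec x 1 z
  obtain ⟨x₀, hx₀⟩ := exists_apply_basisVec_one_ne_zero hx hx0
  have : ContinuousConstSMul H X := ⟨fun h => continuous_const_smul (h : Γ)⟩
  -- Minimality: the `H`-translates of a nonempty open set cover `X`, and compactness leaves
  -- finitely many.
  obtain ⟨F, hF⟩ := isCompact_univ.exists_finite_cover_smul H
    (isOpen_ne_fun e.continuous continuous_const : IsOpen {z | e z ≠ 0})
    ⟨x₀, by simpa [hez] using hx₀⟩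
  let p : C(X, ℝ) := ⟨fun z => ∑ h ∈ F, (e ((h : Γ)⁻¹ • z)).re,
    continuous_finsetSum _ fun h _ => Complex.continuous_re.comp
      (e.continuous.comp (continuous_const_smul _))⟩
  have hp (z : X) : 0 < p z := by
    obtain ⟨h, hhF, hz⟩ := Set.mem_iUnion₂.1 (hF (Set.mem_univ z))
    rw [Set.mem_smul_set_iff_inv_smul_mem] at hz
    refine Finset.sum_pos' (fun i _ => ?_) ⟨h, hhF, ?_⟩
    · rw [hez, Complex.ofReal_re]
      positivity
    · have hne : e ((h : Γ)⁻¹ • z) ≠ 0 := hz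
      rw [hez, Complex.ofReal_ne_zero] at hne
      rw [hez, Complex.ofReal_re]
      exact lt_of_le_of_ne (by positivity) hne.symm
  have hpn (z : X) : p z ≤ ‖p‖ := (le_abs_self _).trans (p.norm_coe_le_norm z)
  have hpos : 0 < ‖p‖ := (hp (Classical.arbitrary X)).trans_le (hpn _)
  -- Scaling by `‖p‖⁻¹` puts the values in `(0, 1]`; compactness makes the pointwise strict bound
  -- uniform.
  refine ⟨F, ((‖p‖⁻¹ : ℝ) : ℂ), fun hb => (ContinuousMap.norm_lt_iff _ one_pos).2 fun z => ?_⟩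
  have hval : condExp Γ (pointRep X) (pointRep_injective X) ⟨_, hb⟩ z =
      ((‖p‖⁻¹ * p z : ℝ) : ℂ) := by
    rw [condExp_apply, ← entry_apply, map_smul, map_sum, Complex.ofReal_mul, smul_eq_mul]
    congr 1
    refine Eq.trans (Finset.sum_congr rfl fun h _ => ?_) (Complex.ofReal_sum F _).symm
    rw [entry_apply, condExp_lam_conj hxx, star_mul_self_basisVec, hez, Complex.ofReal_re]
  rw [ContinuousMap.sub_apply, ContinuousMap.one_apply, hval, ← Complex.ofReal_one,
    ← Complex.ofReal_sub, Complex.norm_real, Real.norm_eq_abs, abs_lt]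
  have h1 : 0 < ‖p‖⁻¹ * p z := mul_pos (inv_pos.2 hpos) (hp z)
  have h2 : ‖p‖⁻¹ * p z ≤ 1 := by
    rw [inv_mul_le_iff₀ hpos, mul_one]
    exact hpn z
  constructor <;> linarith

end Expectation

/-! ### Invertibility in closed subalgebras, and simplicity -/

/-- In a closed unital subalgebra of a Banach algebra, a two-sided ideal that contains an element
at distance less than one from `1` is everything. -/
theorem eq_top_of_norm_one_sub_lt {A : Type*} [NormedRing A] [StarRing A] [NormedAlgebra ℂ A]
    [StarModule ℂ A] [CompleteSpace A] {S : StarSubalgebra ℂ A} (hS : IsClosed (S : Set A))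
    {I : TwoSidedIdeal S} {a : S} (ha : a ∈ I) (h : ‖1 - (a : A)‖ < 1) : I = ⊤ := by
  -- Completeness of `S` makes the Neumann series converge in `S`, so the inverse lies in `S` and
  -- not just in `A`.
  have : CompleteSpace S := hS.completeSpace_coe
  have hu : IsUnit (1 - (1 - a)) := isUnit_one_sub_of_norm_lt_one h
  rw [sub_sub_cancel] at hu
  obtain ⟨u, rfl⟩ := hu
  rw [← TwoSidedIdeal.one_mem_iff, ← u.inv_mul]
  exact I.mul_mem_left _ _ ha

variable {Γ X Y : Type*} [Group Γ] [TopologicalSpace X] [CompactSpace X]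
  [MulAction Γ X] [ContinuousConstSMul Γ X] [TopologicalSpace Y]

theorem sig_comp_mul_lam_mem_reducedSub {K : Type*} [NormedAddCommGroup K] [InnerProductSpace ℂ K]
    [CompleteSpace K] (ρ : C(X, ℂ) →⋆ₐ[ℂ] (K →L[ℂ] K)) (π : C(X, Y)) {H : Subgroup Γ}
    (f : C(Y, ℂ)) (h : H) : sig Γ ρ (f.comp π) * lam (h : Γ) ∈ reducedSub ρ π H :=
  Submodule.le_topologicalClosure _ (Submodule.subset_span ⟨f, h, rfl⟩)

theorem lam_mem_reducedSub {K : Type*} [NormedAddCommGroup K] [InnerProductSpace ℂ K]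
    [CompleteSpace K] (ρ : C(X, ℂ) →⋆ₐ[ℂ] (K →L[ℂ] K)) (π : C(X, Y)) {H : Subgroup Γ}
    (h : H) : lam (h : Γ) ∈ reducedSub ρ π H := by
  have h1 := sig_comp_mul_lam_mem_reducedSub ρ π 1 h
  rwa [ContinuousMap.one_comp, sig_one, one_mul] at h1

theorem sig_comp_mem_reducedSub {K : Type*} [NormedAddCommGroup K] [InnerProductSpace ℂ K]
    [CompleteSpace K] (ρ : C(X, ℂ) →⋆ₐ[ℂ] (K →L[ℂ] K)) (π : C(X, Y)) (H : Subgroup Γ)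
    (f : C(Y, ℂ)) : sig Γ ρ (f.comp π) ∈ reducedSub ρ π H := by
  have h1 := sig_comp_mul_lam_mem_reducedSub ρ π f (1 : H)
  rwa [OneMemClass.coe_one, lam_one, mul_one] at h1

end CrossedProduct

end

/-- Taking `𝒜` unital loses nothing, as `σ(1) λ_e` is the identity operator. -/
theorem theoremC {Γ X Y : Type*} [Group Γ]
    [TopologicalSpace X] [CompactSpace X] [T2Space X] [Nonempty X]
    [MulAction Γ X] [ContinuousConstSMul Γ X]
    [TopologicalSpace Y] [CompactSpace Y] [T2Space Y]
    [MulAction Γ Y] [ContinuousConstSMul Γ Y]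
    (π : C(X, Y)) (hπ : Function.Surjective π) (hequiv : ∀ (s : Γ) (x : X), π (s • x) = s • π x)
    (H : Subgroup Γ) (hmin : MulAction.IsMinimal H X) (hplump : CrossedProduct.IsPlump Y H)
    (𝒜 : StarSubalgebra ℂ (CrossedProduct.L2 Γ (CrossedProduct.L2 X ℂ) →L[ℂ]
      CrossedProduct.L2 Γ (CrossedProduct.L2 X ℂ)))
    (hclosed : IsClosed (𝒜 : Set (CrossedProduct.L2 Γ (CrossedProduct.L2 X ℂ) →L[ℂ]
      CrossedProduct.L2 Γ (CrossedProduct.L2 X ℂ))))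
    (hlower : ∀ a ∈ CrossedProduct.reducedSub (CrossedProduct.pointRep X) π H, a ∈ 𝒜)
    (hupper : ∀ a ∈ 𝒜, a ∈ CrossedProduct.reduced Γ (CrossedProduct.pointRep X)) :
    IsSimpleRing 𝒜 := by
  open CrossedProduct in
  have hnt : Nontrivial (L2 Γ (L2 X ℂ)) := ⟨basisVec 1 (Classical.arbitrary X), 0, fun h => by
    have := norm_basisVec (1 : Γ) (Classical.arbitrary X)
    rw [h, norm_zero] at this
    exact zero_ne_one this⟩
  have : Nontrivial 𝒜 := ⟨1, 0, fun h => one_ne_zero (congrArg Subtype.val h)⟩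
  refine ⟨⟨fun I => or_iff_not_imp_left.2 fun hI => ?_⟩⟩
  obtain ⟨x, hxI, hx0⟩ : ∃ x ∈ I, x ≠ 0 := by
    by_contra! h
    exact hI (le_antisymm (fun x hx => (TwoSidedIdeal.mem_bot _).2 (h x hx)) bot_le)
  -- The lower inclusion puts the unitaries `λ_h` and the weights `γ` in `𝒜`, so conjugation and
  -- averaging keep elements in `I`.
  let ℓ (h : H) : 𝒜 := ⟨lam (h : Γ), hlower _ (lam_mem_reducedSub _ π h)⟩
  obtain ⟨F, c, hF⟩ := exists_norm_one_sub_condExp_lt H hmin (hupper _ x.2)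
    (fun h => hx0 (Subtype.ext h)) (hupper _ (star x * x).2)
  let b : 𝒜 := c • ∑ h ∈ F, ℓ h * (star x * x) * star (ℓ h)
  have hbI : b ∈ I := by
    have hmem : ∑ h ∈ F, ℓ h * (star x * x) * star (ℓ h) ∈ I := sum_mem fun h _ =>
      I.mul_mem_right _ _ (I.mul_mem_left _ _ (I.mul_mem_left _ _ hxI))
    have := I.mul_mem_left (algebraMap ℂ 𝒜 c) _ hmem
    rwa [← Algebra.smul_def] at this
  have hb : (b : L2 Γ (L2 X ℂ) →L[ℂ] L2 Γ (L2 X ℂ)) = c • ∑ h ∈ F, lam (h : Γ) *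
      (star (x : L2 Γ (L2 X ℂ) →L[ℂ] L2 Γ (L2 X ℂ)) * x.1) * star (lam (K := L2 X ℂ) (h : Γ)) := by
    exact congrArg (c • ·) (AddSubmonoidClass.coe_finsetSum _ F)
  have hbm := hupper _ b.2
  rw [hb] at hbm
  obtain ⟨m, s, g, hsg⟩ := hplump.exists_norm_one_sub_average_lt π hequiv ⟨_, hbm⟩ (hF hbm)
  let γ (j : Fin m) : 𝒜 := ⟨sig Γ (pointRep X) ((g j).comp π),
    hlower _ (sig_comp_mem_reducedSub _ π H (g j))⟩
  have hmem : ∑ j, γ j * ℓ (s j) * b * star (ℓ (s j)) * γ j ∈ I := sum_mem fun j _ =>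
    I.mul_mem_right _ _ (I.mul_mem_right _ _ (I.mul_mem_left _ _ hbI))
  refine eq_top_of_norm_one_sub_lt hclosed hmem ?_
  simp only [← hb] at hsg
  have havg := (AddSubmonoidClass.coe_finsetSum
    (fun j => γ j * ℓ (s j) * b * star (ℓ (s j)) * γ j) Finset.univ).symm
  exact (congrArg (fun T => ‖1 - T‖) havg).symm.trans_lt hsg
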